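/- Let $\mathbb{D}$ be the open unit disk, $\mathbb{T}$ the unit circle with normalized Lebesgue measure $m$, and $\mathbb{D}_e=\{|z|>1\}\cup\{\infty\}$. Let $H^2$ be the Hardy space of analytic functions $f$ on $\mathbb{D}$ with $\lim_{r\to1^-}\int_{\mathbb{T}}|f(r\zeta)|^2\,dm(\zeta)<\infty$, with inner product $\langle f,g\rangle=\int_{\mathbb{T}}f\,\overline{g}\,dm$ of the radial boundary functions, and let $H^2(\mathbb{D}_e)=\{g(1/z): g\in H^2\}$. Let $u$ be an inner function, that is, a bounded analytic function on $\mathbb{D}$ whose radial limits have modulus $1$ almost everywhere on $\mathbb{T}$, and let $\mathcal{K}_u=H^2\ominus uH^2=\{f\in H^2:\langle f,uh\rangle=0\text{ for all }h\in H^2\}$. Meromorphic functions $g$ on $\mathbb{D}$ and $G$ on $\mathbb{D}_e$ are called pseudocontinuations of one another if, for almost every $\zeta\in\mathbb{T}$, the nontangential limit of $g$ at $\zeta$ (from $\mathbb{D}$) and the nontangential limit of $G$ at $\zeta$ (from $\mathbb{D}_e$) exist and agree. Here nontangential limits are limits within every Stolz region $\{z\in\mathbb{D}:|z-\zeta|<\alpha(1-|z|)\}$,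 respectively $\{|z|>1:|z-\zeta|<\alpha(|z|-1)\}$, $\alpha>1$. **Theorem (Douglas–Shapiro–Shields).** A function $f\in H^2$ belongs to $\mathcal{K}_u$ if and only if $f/u$ has a pseudocontinuation $F_u\in H^2(\mathbb{D}_e)$ with $F_u(\infty)=0$. -/

import Mathlib

open Filter Topology MeasureTheory Metric
open scoped ComplexConjugate Real

noncomputable section

namespace ModelSpace

/-- Normalized Lebesgue measure `m` on the unit circle `𝕋`, as a probability measure on `ℂ`
carried by `𝕋`. -/
def circleMeasure : Measure ℂ :=
  haveI : Fact (0 < 2 * π) := ⟨Real.two_pi_pos⟩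
  Measure.map (fun t : AddCircle (2 * π) => (AddCircle.toCircle t : ℂ)) AddCircle.haarAddCircle

/-- `f ∈ H²`: `f` is analytic on the unit disk and the limit as `r → 1⁻` of its (increasing)
quadratic integral means is finite. Functions on `𝔻` are represented by functions on `ℂ` whose
values off `𝔻` are irrelevant. -/
def MemH2 (f : ℂ → ℂ) : Prop :=
  DifferentiableOn ℂ f (ball 0 1) ∧
    ∃ L : ℝ, Tendsto (fun r : ℝ => ∫ ζ, ‖f (r * ζ)‖ ^ 2 ∂circleMeasure) (𝓝[<] 1) (𝓝 L)

/-- The radial boundary function `ζ ↦ lim_{r → 1⁻} f (r ζ)`. For functions in `H²` the limit exists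
for almost every `ζ ∈ 𝕋`. -/
def boundaryValue (f : ℂ → ℂ) (ζ : ℂ) : ℂ :=
  limUnder (𝓝[<] (1 : ℝ)) (fun r : ℝ => f (r * ζ))

/-- The inner product `⟨f, g⟩ = ∫_𝕋 f(ζ) conj(g(ζ)) dm(ζ)` of `H²`. -/
def innerH2 (f g : ℂ → ℂ) : ℂ :=
  ∫ ζ, boundaryValue f ζ * conj (boundaryValue g ζ) ∂circleMeasure

/-- `u` is an inner function: bounded and analytic on `𝔻`, with radial limits of modulus one at
almost every point of `𝕋`. -/
def IsInner (u : ℂ → ℂ) : Prop :=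
  DifferentiableOn ℂ u (ball 0 1) ∧
    (∃ C : ℝ, ∀ z ∈ ball (0 : ℂ) 1, ‖u z‖ ≤ C) ∧
    ∀ᵐ ζ ∂circleMeasure, ∃ L : ℂ, ‖L‖ = 1 ∧
      Tendsto (fun r : ℝ => u (r * ζ)) (𝓝[<] 1) (𝓝 L)

/-- The model space `K_u = H² ⊖ u H²`. -/
def modelSpace (u : ℂ → ℂ) : Set (ℂ → ℂ) :=
  {f | MemH2 f ∧ ∀ h : ℂ → ℂ, MemH2 h → innerH2 f (fun z => u z * h z) = 0}

/-- The Stolz region in `𝔻` with vertex `ζ ∈ 𝕋` and aperture `α`. -/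
def stolz (α : ℝ) (ζ : ℂ) : Set ℂ :=
  {z | ‖z‖ < 1 ∧ ‖z - ζ‖ < α * (1 - ‖z‖)}

/-- The Stolz region in the exterior `{|z| > 1}` with vertex `ζ ∈ 𝕋` and aperture `α`. It is the
image of `stolz α ζ ∖ {0}` under the reflection `z ↦ 1 / conj z`. -/
def stolzExt (α : ℝ) (ζ : ℂ) : Set ℂ :=
  {z | 1 < ‖z‖ ∧ ‖z - ζ‖ < α * (‖z‖ - 1)}

/-- `f` has nontangential limit `L` at `ζ` from the unit disk. -/
def HasNTLimit (f : ℂ → ℂ) (ζ L : ℂ) : Prop :=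
  ∀ α : ℝ, 1 < α → Tendsto f (𝓝[stolz α ζ] ζ) (𝓝 L)

/-- A function on the extended exterior disk `𝔻_e = {|z| > 1} ∪ {∞}`, given on the Riemann sphere
`OnePoint ℂ`, has nontangential limit `L` at `ζ` from `𝔻_e`. -/
def HasNTLimitExt (F : OnePoint ℂ → ℂ) (ζ L : ℂ) : Prop :=
  ∀ α : ℝ, 1 < α → Tendsto (fun z : ℂ => F (z : OnePoint ℂ)) (𝓝[stolzExt α ζ] ζ) (𝓝 L)

/-- The coordinate `w ↦ 1 / w` of the Riemann sphere, with `1 / 0 = ∞`. It maps `𝔻` onto `𝔻_e`. -/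
def invSphere (w : ℂ) : OnePoint ℂ :=
  if w = 0 then OnePoint.infty else ((w⁻¹ : ℂ) : OnePoint ℂ)

/-- `F` is meromorphic on `𝔻_e` (including at `∞`), expressed in the coordinate `w = 1 / z`. -/
def MeromorphicOnExt (F : OnePoint ℂ → ℂ) : Prop :=
  MeromorphicOn (fun w : ℂ => F (invSphere w)) (ball 0 1)

/-- `F ∈ H²(𝔻_e) = {g(1/z) : g ∈ H²}`. -/
def MemH2Ext (F : OnePoint ℂ → ℂ) : Prop :=
  ∃ g : ℂ → ℂ, MemH2 g ∧ (∀ z : ℂ, 1 < ‖z‖ → F (z : OnePoint ℂ) = g (1 / z)) ∧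
    F OnePoint.infty = g 0

/-- `f` (meromorphic on `𝔻`) and `F` (meromorphic on `𝔻_e`) are pseudocontinuations of one another:
at almost every point of `𝕋` both have a nontangential limit, and the two limits agree. -/
def IsPseudocontinuation (f : ℂ → ℂ) (F : OnePoint ℂ → ℂ) : Prop :=
  MeromorphicOn f (ball 0 1) ∧ MeromorphicOnExt F ∧
    ∀ᵐ ζ ∂circleMeasure, ∃ L : ℂ, HasNTLimit f ζ L ∧ HasNTLimitExt F ζ L

end ModelSpace

end

/-
Taking boundary functions identifies `H²` with the functions in `L²(𝕋)` whose Fourier coefficients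
of negative index vanish: by Riesz–Fischer and Parseval every such function `φ` has a Poisson
integral `∑ φ̂(n) zⁿ` in `H²`, every element of `H²` arises in this way, and by Fatou's theorem the
Poisson integral has nontangential limit `φ` at every Lebesgue point of `φ`.

For `f ∈ H²` and `u` inner, let `q = f ū` on `𝕋`. Since `⟨f, u h⟩ = ∫ q h̄ dm`, testing with the
monomials `h = zⁿ` shows that `f ∈ K_u` if and only if `q̂(n) = 0` for all `n ≥ 0`. Since `|u| = 1`
on `𝕋`, the function `q` is also the nontangential boundary function of `f / u`. Finally,
`q̂(n) = 0` for all `n ≥ 0` if and only if `ζ ↦ q(ζ̄)` is the boundary function of some `G ∈ H²`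
with `G(0) = 0`. As `z ↦ 1 / z` exchanges Stolz regions of `𝔻` at `ζ` with those of `𝔻_e` at `ζ̄`,
this says that `G(1 / z)` is a pseudocontinuation of `f / u` in `H²(𝔻_e)` vanishing at `∞`.
-/

namespace ModelSpace

section BallDensity

variable {X : Type*} [PseudoMetricSpace X] {ψ : X → ℝ} {t : X}

lemma exists_le_two_pow_mul {h : ℝ} (hh : 0 < h) (d : ℝ) :
    ∃ k : ℕ, d ≤ 2 ^ k * h ∧ (2 ^ k * h) ^ 2 ≤ 4 * (h ^ 2 + d ^ 2) := by
  rcases le_or_gt d h with hd | hd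
  · exact ⟨0, by simpa using hd, by nlinarith [sq_nonneg h, sq_nonneg d]⟩
  · obtain ⟨k, hk, hk'⟩ := exists_nat_pow_near ((one_le_div hh).2 hd.le) one_lt_two
    rw [le_div_iff₀ hh] at hk
    refine ⟨k + 1, ((div_lt_iff₀ hh).1 hk').le, ?_⟩
    have hsq : (2 ^ k * h) ^ 2 ≤ d ^ 2 := by gcongr
    calc (2 ^ (k + 1) * h) ^ 2 = 4 * (2 ^ k * h) ^ 2 := by ring
      _ ≤ 4 * (h ^ 2 + d ^ 2) := by gcongr; linarith [sq_nonneg h]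

lemma enorm_le_tsum_indicator_closedBall {E : Type*} [NormedAddCommGroup E] {h C : ℝ}
    (hh : 0 < h) {g : X → E} {s : X}
    (hg : ‖g s‖ * (h ^ 2 + dist s t ^ 2) ≤ C * h * ψ s) :
    ‖g s‖ₑ ≤ ∑' k : ℕ, (closedBall t (2 ^ k * h)).indicator
      (fun s => ENNReal.ofReal (4 * C * (1 / 2) ^ k / (2 ^ k * h) * ψ s)) s := by
  obtain ⟨k, hk, hk'⟩ := exists_le_two_pow_mul hh (dist s t)
  refine le_trans ?_ (ENNReal.le_tsum k)
  rw [Set.indicator_of_mem (mem_closedBall.2 hk), ← ofReal_norm]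
  have hpos : 0 < (2 ^ k * h) ^ 2 := by positivity
  refine ENNReal.ofReal_le_ofReal (le_of_mul_le_mul_right ?_ hpos)
  calc ‖g s‖ * (2 ^ k * h) ^ 2 ≤ 4 * (‖g s‖ * (h ^ 2 + dist s t ^ 2)) := by
        rw [mul_left_comm]; gcongr
    _ ≤ 4 * (C * h * ψ s) := mul_le_mul_of_nonneg_left hg zero_le_four
    _ = 4 * C * (1 / 2) ^ k / (2 ^ k * h) * ψ s * (2 ^ k * h) ^ 2 := by
        simp only [one_div, inv_pow]; field_simp

variable [MeasurableSpace X] {μ : Measure X}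

/-- The density at scale `r` around `t` of the measure with density `ψ` with respect to `μ`. The
normalization by `r` makes it an average, up to a constant, on one-dimensional spaces. -/
noncomputable def ballDensity (μ : Measure X) (ψ : X → ℝ) (t : X) (r : ℝ) : ℝ :=
  (∫ s in closedBall t r, ψ s ∂μ) / r

lemma ballDensity_nonneg (hψ0 : 0 ≤ ψ) {r : ℝ} (hr : 0 ≤ r) : 0 ≤ ballDensity μ ψ t r :=
  div_nonneg (integral_nonneg hψ0) hr

lemma ballDensity_le (hψ : Integrable ψ μ) (hψ0 : 0 ≤ ψ) {r : ℝ} (hr : 0 ≤ r) :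
    ballDensity μ ψ t r ≤ (∫ s, ψ s ∂μ) / r :=
  div_le_div_of_nonneg_right (setIntegral_le_integral hψ (ae_of_all _ hψ0)) hr

lemma exists_ballDensity_le (hψ : Integrable ψ μ) (hψ0 : 0 ≤ ψ)
    (ht : Tendsto (ballDensity μ ψ t) (𝓝[>] 0) (𝓝 0)) :
    ∃ M : ℝ, ∀ r, 0 < r → ballDensity μ ψ t r ≤ M := by
  obtain ⟨δ, hδ : 0 < δ, hsmall⟩ :=
    mem_nhdsGT_iff_exists_Ioc_subset.1 (ht.eventually_le_const one_pos)
  have hint : 0 ≤ ∫ s, ψ s ∂μ := integral_nonneg hψ0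
  refine ⟨max 1 ((∫ s, ψ s ∂μ) / δ), fun r hr => ?_⟩
  rcases le_or_gt r δ with hrδ | hδr
  · exact le_max_of_le_left (hsmall ⟨hr, hrδ⟩)
  · exact le_max_of_le_right ((ballDensity_le hψ hψ0 hr.le).trans (by gcongr))

lemma summable_two_pow_mul_ballDensity (hψ : Integrable ψ μ) (hψ0 : 0 ≤ ψ) {h : ℝ} (hh : 0 < h) :
    Summable fun k : ℕ => (1 / 2 : ℝ) ^ k * ballDensity μ ψ t (2 ^ k * h) := by
  refine .of_nonneg_of_le
    (fun k => mul_nonneg (by positivity) (ballDensity_nonneg hψ0 (by positivity)))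
    (fun k => ?_) (summable_geometric_two.mul_right ((∫ s, ψ s ∂μ) / h))
  gcongr
  refine (ballDensity_le hψ hψ0 (by positivity)).trans ?_
  have hint : 0 ≤ ∫ s, ψ s ∂μ := integral_nonneg hψ0
  gcongr
  exact le_mul_of_one_le_left hh.le (one_le_pow₀ one_le_two)

variable {E : Type*} [NormedAddCommGroup E] [NormedSpace ℝ E]

-- On a ball of radius `2 ^ k * h` whose radius is comparable to `h + dist s t`, the hypothesis
-- bounds `g` by a multiple of `ψ / (4 ^ k * h)`, and summing over all `k` covers every `s`.
lemma norm_integral_le_tsum_ballDensity [OpensMeasurableSpace X] (hψ : Integrable ψ μ)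
    (hψ0 : 0 ≤ ψ) {h C : ℝ} (hh : 0 < h) (hC : 0 ≤ C) {g : X → E}
    (hg : ∀ s, ‖g s‖ * (h ^ 2 + dist s t ^ 2) ≤ C * h * ψ s) :
    ‖∫ s, g s ∂μ‖ ≤ 4 * C * ∑' k : ℕ, (1 / 2) ^ k * ballDensity μ ψ t (2 ^ k * h) := by
  set w : ℕ → ℝ := fun k => 4 * C * (1 / 2) ^ k / (2 ^ k * h) with hw
  have hw0 (k : ℕ) : 0 ≤ w k := by positivity
  have hψm (k : ℕ) : AEMeasurable (fun s => ENNReal.ofReal (w k * ψ s)) μ :=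
    (hψ.aemeasurable.const_mul (w k)).ennreal_ofReal
  have hterm (k : ℕ) :
      ∫⁻ s, (closedBall t (2 ^ k * h)).indicator (fun s => ENNReal.ofReal (w k * ψ s)) s ∂μ =
        ENNReal.ofReal (4 * C * ((1 / 2) ^ k * ballDensity μ ψ t (2 ^ k * h))) := by
    rw [lintegral_indicator measurableSet_closedBall, ← ofReal_integral_eq_lintegral_ofReal
      (hψ.restrict.const_mul _) (ae_of_all _ fun s => mul_nonneg (hw0 k) (hψ0 s)),
      integral_const_mul, hw, ballDensity]
    ring_nf
  have hnonneg (k : ℕ) : 0 ≤ 4 * C * ((1 / 2) ^ k * ballDensity μ ψ t (2 ^ k * h)) :=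
    mul_nonneg (by positivity) (mul_nonneg (by positivity) (ballDensity_nonneg hψ0 (by positivity)))
  have hle : ‖∫ s, g s ∂μ‖ₑ ≤
      ENNReal.ofReal (∑' k, 4 * C * ((1 / 2) ^ k * ballDensity μ ψ t (2 ^ k * h))) := by
    refine (enorm_integral_le_lintegral_enorm g).trans
      ((lintegral_mono fun s => enorm_le_tsum_indicator_closedBall hh (hg s)).trans_eq ?_)
    rw [lintegral_tsum fun k => (hψm k).indicator measurableSet_closedBall, tsum_congr hterm,
      ENNReal.ofReal_tsum_of_nonneg hnonneg
        ((summable_two_pow_mul_ballDensity hψ hψ0 hh).mul_left (4 * C))]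
  rw [← tsum_mul_left]
  exact (ENNReal.ofReal_le_ofReal_iff (tsum_nonneg hnonneg)).1 (by rwa [ofReal_norm])

lemma tendsto_tsum_ballDensity (hψ : Integrable ψ μ) (hψ0 : 0 ≤ ψ)
    (ht : Tendsto (ballDensity μ ψ t) (𝓝[>] 0) (𝓝 0)) :
    Tendsto (fun h => ∑' k : ℕ, (1 / 2) ^ k * ballDensity μ ψ t (2 ^ k * h)) (𝓝[>] 0) (𝓝 0) := by
  obtain ⟨M, hM⟩ := exists_ballDensity_le hψ hψ0 ht
  suffices hlim : Tendsto (fun h => ∑' k : ℕ, (1 / 2) ^ k * ballDensity μ ψ t (2 ^ k * h))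
      (𝓝[>] 0) (𝓝 (∑' _ : ℕ, 0)) by simpa only [tsum_zero] using hlim
  refine tendsto_tsum_of_dominated_convergence (summable_geometric_two.mul_right M)
    (fun k => ?_) ?_
  · have hscale : Tendsto (fun h : ℝ => 2 ^ k * h) (𝓝[>] 0) (𝓝[>] 0) :=
      tendsto_nhdsWithin_iff.2 ⟨(Continuous.tendsto' (by fun_prop) 0 0 (by simp)).mono_left
        nhdsWithin_le_nhds, eventually_mem_nhdsWithin.mono fun h (hh : 0 < h) =>
          (by positivity : 0 < 2 ^ k * h)⟩
    simpa using (ht.comp hscale).const_mul ((1 / 2 : ℝ) ^ k)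
  · filter_upwards [self_mem_nhdsWithin] with h (hh : 0 < h) k
    have hnonneg : 0 ≤ ballDensity μ ψ t (2 ^ k * h) := ballDensity_nonneg hψ0 (by positivity)
    rw [Real.norm_of_nonneg (by positivity)]
    gcongr
    exact hM _ (by positivity)

lemma tendsto_integral_zero_of_norm_mul_le [OpensMeasurableSpace X] (hψ : Integrable ψ μ)
    (hψ0 : 0 ≤ ψ) (ht : Tendsto (ballDensity μ ψ t) (𝓝[>] 0) (𝓝 0)) {ι : Type*} {l : Filter ι}
    {h : ι → ℝ} (hh : Tendsto h l (𝓝[>] 0)) {C : ℝ} (hC : 0 ≤ C) {g : ι → X → E}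
    (hg : ∀ᶠ i in l, ∀ s, ‖g i s‖ * (h i ^ 2 + dist s t ^ 2) ≤ C * h i * ψ s) :
    Tendsto (fun i => ∫ s, g i s ∂μ) l (𝓝 0) := by
  refine squeeze_zero_norm' ?_ (by
    simpa only [mul_zero] using
      ((tendsto_tsum_ballDensity hψ hψ0 ht).comp hh).const_mul (4 * C))
  filter_upwards [hg, (tendsto_nhdsWithin_iff.1 hh).2] with i hi hpos
  exact norm_integral_le_tsum_ballDensity hψ hψ0 hpos hC hi

end BallDensity

open AddCircle

section Circle

variable {T : ℝ}

lemma fourier_eq_zpow (n : ℤ) (t : AddCircle T) : fourier n t = (toCircle t : ℂ) ^ n := by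
  rw [fourier_apply, toCircle_zsmul, Circle.coe_zpow]

variable [Fact (0 < T)]

lemma measurableEmbedding_toCircle :
    MeasurableEmbedding fun t : AddCircle T => (toCircle t : ℂ) :=
  (((continuous_subtype_val.comp continuous_toCircle).isClosedEmbedding
    (Circle.coe_injective.comp (injective_toCircle (Fact.out : 0 < T).ne')))).measurableEmbedding

lemma ae_tendsto_ballDensity_norm_sub {E : Type*} [NormedAddCommGroup E] [NormedSpace ℝ E]
    {φ : AddCircle T → E} (hφ : Integrable φ haarAddCircle) :
    ∀ᵐ t ∂haarAddCircle,
      Tendsto (ballDensity haarAddCircle (fun s => ‖φ s - φ t‖) t) (𝓝[>] 0) (𝓝 0) := by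
  have hT : 0 < T := Fact.out
  have hvol : (volume : Measure (AddCircle T)) = ENNReal.ofReal T • haarAddCircle :=
    volume_eq_smul_haarAddCircle
  have hφ' : LocallyIntegrable φ (volume : Measure (AddCircle T)) := by
    rw [hvol]
    exact (hφ.smul_measure ENNReal.ofReal_ne_top).locallyIntegrable
  have hLebesgue := IsUnifLocDoublingMeasure.ae_tendsto_average_norm_sub volume hφ' 1
  rw [hvol, Measure.ae_ennreal_smul_measure_eq (by simpa using hT), ← hvol] at hLebesgue
  filter_upwards [hLebesgue] with t ht
  have hcenter : ∀ᶠ r in 𝓝[>] (0 : ℝ), t ∈ closedBall t (1 * r) :=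
    eventually_mem_nhdsWithin.mono fun r (hr : 0 < r) =>
      mem_closedBall_self (by simpa using hr.le)
  have hlim := (ht (fun _ => t) id tendsto_id hcenter).const_mul (2 / T)
  rw [mul_zero] at hlim
  refine hlim.congr' ?_
  filter_upwards [Ioc_mem_nhdsGT (half_pos hT)] with r hr
  have hr0 : 0 < r := hr.1
  rw [id, ballDensity, setAverage_eq, measureReal_def, volume_closedBall,
    min_eq_right (by linarith [hr.2]), ENNReal.toReal_ofReal (by positivity), hvol,
    Measure.restrict_smul, integral_smul_measure, ENNReal.toReal_ofReal hT.le, smul_eq_mul,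
    smul_eq_mul]
  field_simp

lemma hasSum_fourierCoeff_smul {E : Type*} [NormedAddCommGroup E] [NormedSpace ℂ E]
    [CompleteSpace E] {ι : Type*} [Countable ι] {a : ι → ℂ} (ha : Summable fun i => ‖a i‖)
    {k : ι → ℤ} {K : AddCircle T → ℂ} (hK : ∀ t, HasSum (fun i => a i * fourier (-k i) t) (K t))
    {φ : AddCircle T → E} (hφ : Integrable φ haarAddCircle) :
    HasSum (fun i => a i • fourierCoeff φ (k i)) (∫ t, K t • φ t ∂haarAddCircle) := by
  have hnorm (i : ι) (t : AddCircle T) :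
      ‖a i • (fourier (-k i) t • φ t)‖ = ‖a i‖ * ‖φ t‖ := by
    rw [norm_smul, norm_smul, fourier_eq_zpow, norm_zpow, Circle.norm_coe, one_zpow, one_mul]
  have hsum : Summable fun i =>
      ∫ t, ‖a i • (fourier (-k i) t • φ t)‖ ∂(haarAddCircle : Measure (AddCircle T)) := by
    simp only [hnorm, integral_const_mul]
    exact ha.mul_right _
  have htsum (t : AddCircle T) : ∑' i, a i • (fourier (-k i) t • φ t) = K t • φ t := by
    simp only [← mul_smul]
    exact ((hK t).smul_const (φ t)).tsum_eq
  have hmain := hasSum_integral_of_summable_integral_norm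
    (fun i => (hφ.fourier_smul (-k i)).smul (a i)) hsum
  simp only [Pi.smul_apply, integral_smul, htsum] at hmain
  exact hmain

lemma fourierCoeff_eq_extend_of_hasSum {ι : Type*} [Countable ι] {a : ι → ℂ}
    (ha : Summable fun i => ‖a i‖) {k : ι → ℤ} (hk : k.Injective) {g : AddCircle T → ℂ}
    (hg : ∀ t, HasSum (fun i => a i * fourier (k i) t) (g t)) :
    fourierCoeff g = Function.extend k a 0 := by
  funext m
  have hsum := hasSum_fourierCoeff_smul ha (k := fun i => -k i) (by simpa only [neg_neg] using hg)
    ((map_continuous (fourier (-m))).integrable_of_hasCompactSupport (.of_compactSpace _))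
  simp only [fourierCoeff_fourier, Pi.single_apply, neg_inj, smul_eq_mul, mul_ite, mul_one,
    mul_zero] at hsum
  have hcoeff : fourierCoeff g m = ∫ t, g t * fourier (-m) t ∂haarAddCircle :=
    integral_congr_ae (ae_of_all _ fun t => mul_comm _ _)
  rw [hcoeff]
  by_cases hm : ∃ i, k i = m
  · obtain ⟨i, rfl⟩ := hm
    rw [hk.extend_apply]
    have hsingle := hasSum_single i fun j hj =>
      (if_neg (hk.ne hj) : (if k j = k i then a j else 0) = 0)
    rw [if_pos rfl] at hsingle
    exact hsum.unique hsingle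
  · rw [Function.extend_apply' _ _ _ hm]
    exact hsum.unique (hasSum_zero.congr_fun fun i => if_neg fun hi => hm ⟨i, hi⟩)

lemma hasSum_sq_fourierCoeff_of_memLp {φ : AddCircle T → ℂ} (hφ : MemLp φ 2 haarAddCircle) :
    HasSum (fun n => ‖fourierCoeff φ n‖ ^ 2) (∫ t, ‖φ t‖ ^ 2 ∂haarAddCircle) := by
  have hsum := hasSum_sq_fourierCoeff (hφ.toLp φ)
  rw [fourierCoeff_congr_ae hφ.coeFn_toLp] at hsum
  exact integral_congr_ae (hφ.coeFn_toLp.fun_comp (‖·‖ ^ 2)) ▸ hsum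

lemma hasSum_norm_sq_of_hasSum_fourier {ι : Type*} [Countable ι] {a : ι → ℂ}
    (ha : Summable fun i => ‖a i‖) {k : ι → ℤ} (hk : k.Injective) {g : AddCircle T → ℂ}
    (hg : ∀ t, HasSum (fun i => a i * fourier (k i) t) (g t)) (hg2 : MemLp g 2 haarAddCircle) :
    HasSum (fun i => ‖a i‖ ^ 2) (∫ t, ‖g t‖ ^ 2 ∂haarAddCircle) := by
  have hsum := hasSum_sq_fourierCoeff_of_memLp hg2
  rw [fourierCoeff_eq_extend_of_hasSum ha hk hg, ← hk.hasSum_iff] at hsum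
  · simpa only [Function.comp_def, hk.extend_apply] using hsum
  · intro n hn
    rw [Function.extend_apply' _ _ _ hn, Pi.zero_apply, norm_zero, zero_pow two_ne_zero]

lemma exists_memLp_fourierCoeff_eq {a : ℤ → ℂ} (ha : Summable fun n => ‖a n‖ ^ 2) :
    ∃ φ : AddCircle T → ℂ, MemLp φ 2 haarAddCircle ∧ fourierCoeff φ = a := by
  have hmem : Memℓp a 2 := memℓp_gen (by simpa using ha)
  refine ⟨fourierBasis.repr.symm ⟨a, hmem⟩, Lp.memLp _, funext fun n => ?_⟩
  rw [← fourierBasis_repr, LinearIsometryEquiv.apply_symm_apply]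

lemma integral_mul_conj_eq_zero_of_fourierCoeff {φ ψ : AddCircle T → ℂ}
    (hφ : MemLp φ 2 haarAddCircle) (hψ : MemLp ψ 2 haarAddCircle)
    (h : ∀ n, fourierCoeff φ n = 0 ∨ fourierCoeff ψ n = 0) :
    ∫ t, φ t * conj (ψ t) ∂haarAddCircle = 0 := by
  have hinner : inner ℂ (hψ.toLp ψ) (hφ.toLp φ) = 0 := by
    rw [← fourierBasis.repr.inner_map_map, lp.inner_eq_tsum]
    refine (tsum_congr fun n => ?_).trans tsum_zero
    rw [fourierBasis_repr, fourierBasis_repr, fourierCoeff_congr_ae hφ.coeFn_toLp,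
      fourierCoeff_congr_ae hψ.coeFn_toLp]
    rcases h n with hn | hn <;> simp [hn]
  rw [← hinner, L2.inner_def]
  refine integral_congr_ae ?_
  filter_upwards [hφ.coeFn_toLp, hψ.coeFn_toLp] with t htφ htψ
  rw [htφ, htψ, RCLike.inner_apply]

lemma fourierCoeff_comp_neg {E : Type*} [NormedAddCommGroup E] [NormedSpace ℂ E]
    (φ : AddCircle T → E) (n : ℤ) :
    fourierCoeff (fun t => φ (-t)) n = fourierCoeff φ (-n) := by
  rw [fourierCoeff, fourierCoeff, ← integral_neg_eq_self _ haarAddCircle]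
  simp only [neg_neg, fourier_apply, smul_neg, neg_smul]

lemma fourierCoeff_one : fourierCoeff (fun _ : AddCircle T => (1 : ℂ)) = Pi.single 0 1 :=
  (congrArg fourierCoeff (funext fun _ => fourier_zero.symm)).trans (fourierCoeff_fourier 0)

end Circle

lemma fact_two_pi_pos : Fact (0 < 2 * π) := ⟨Real.two_pi_pos⟩

attribute [local instance] fact_two_pi_pos

lemma dist_le_mul_norm_toCircle_sub (s t : AddCircle (2 * π)) :
    dist s t ≤ π / 2 * ‖(toCircle s : ℂ) - toCircle t‖ := by
  have harg : s - t = (Complex.arg (toCircle s / toCircle t : Circle) : AddCircle (2 * π)) := by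
    refine injective_toCircle Real.two_pi_pos.ne' ?_
    rw [toCircle_apply_mk, div_self Real.two_pi_pos.ne', one_mul, Circle.exp_arg, sub_eq_add_neg,
      toCircle_add, toCircle_neg, div_eq_mul_inv]
  refine le_trans ?_ (Complex.angle_le_mul_norm_sub (Circle.norm_coe _) (Circle.norm_coe _))
  rw [Complex.angle_eq_abs_arg (Circle.coe_ne_zero _) (Circle.coe_ne_zero _), dist_eq_norm, harg,
    ← Circle.coe_div]
  exact QuotientAddGroup.norm_mk_le_norm

lemma ae_circleMeasure_iff {p : ℂ → Prop} :
    (∀ᵐ ζ ∂circleMeasure, p ζ) ↔ ∀ᵐ t : AddCircle (2 * π) ∂haarAddCircle, p (toCircle t) :=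
  measurableEmbedding_toCircle.ae_map_iff

lemma integral_circleMeasure {E : Type*} [NormedAddCommGroup E] [NormedSpace ℝ E] (g : ℂ → E) :
    ∫ ζ, g ζ ∂circleMeasure = ∫ t : AddCircle (2 * π), g (toCircle t) ∂haarAddCircle :=
  measurableEmbedding_toCircle.integral_map g

section PoissonIntegral

variable {z : ℂ}

lemma poissonKernel_zero_circle (z : ℂ) (ζ : Circle) :
    poissonKernel 0 z ζ = (1 - ‖z‖ ^ 2) / ‖(ζ : ℂ) - z‖ ^ 2 := by
  rw [poissonKernel_def, sub_zero, sub_zero, Circle.norm_coe, one_pow]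

lemma one_sub_norm_le_norm_circle_sub (z : ℂ) (ζ : Circle) : 1 - ‖z‖ ≤ ‖(ζ : ℂ) - z‖ := by
  simpa only [Circle.norm_coe] using norm_sub_norm_le (ζ : ℂ) z

lemma poissonKernel_circle_nonneg (hz : ‖z‖ < 1) (ζ : Circle) : 0 ≤ poissonKernel 0 z ζ := by
  rw [poissonKernel_zero_circle]
  exact div_nonneg (sub_nonneg.2 (pow_le_one₀ (norm_nonneg z) hz.le)) (sq_nonneg _)

lemma continuous_poissonKernel_circle (hz : ‖z‖ < 1) :
    Continuous fun ζ : Circle => poissonKernel 0 z ζ := by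
  simp only [poissonKernel_zero_circle]
  refine continuous_const.div (by fun_prop) fun ζ => pow_ne_zero 2 ?_
  linarith [one_sub_norm_le_norm_circle_sub z ζ]

lemma poissonKernel_mul_le {α : ℝ} {t : AddCircle (2 * π)} (hz : z ∈ stolz α (toCircle t))
    (s : AddCircle (2 * π)) :
    poissonKernel 0 z (toCircle s) * ((1 - ‖z‖) ^ 2 + dist s t ^ 2) ≤
      2 * (1 + (π / 2 * (1 + α)) ^ 2) * (1 - ‖z‖) := by
  set δ := ‖(toCircle s : ℂ) - z‖ with hδ_def
  have hgap : 0 < 1 - ‖z‖ := sub_pos.2 hz.1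
  have hδ : 1 - ‖z‖ ≤ δ := one_sub_norm_le_norm_circle_sub z (toCircle s)
  have hδ0 : 0 < δ := hgap.trans_le hδ
  have hα : 0 < α := pos_of_mul_pos_left ((norm_nonneg _).trans_lt hz.2) hgap.le
  have hdist : dist s t ≤ π / 2 * (1 + α) * δ :=
    calc dist s t ≤ π / 2 * ‖(toCircle s : ℂ) - toCircle t‖ := dist_le_mul_norm_toCircle_sub s t
      _ ≤ π / 2 * (δ + α * (1 - ‖z‖)) := by
          gcongr
          exact (norm_sub_le_norm_sub_add_norm_sub _ z _).trans (by gcongr; exact hz.2.le)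
      _ ≤ π / 2 * (1 + α) * δ := by rw [mul_assoc, one_add_mul]; gcongr
  have hsq : (1 - ‖z‖) ^ 2 + dist s t ^ 2 ≤ (1 + (π / 2 * (1 + α)) ^ 2) * δ ^ 2 := by
    rw [one_add_mul, ← mul_pow]
    gcongr
  calc poissonKernel 0 z (toCircle s) * ((1 - ‖z‖) ^ 2 + dist s t ^ 2)
      ≤ poissonKernel 0 z (toCircle s) * ((1 + (π / 2 * (1 + α)) ^ 2) * δ ^ 2) := by
        gcongr
        exact poissonKernel_circle_nonneg hz.1 _
    _ = (1 + (π / 2 * (1 + α)) ^ 2) * ((1 + ‖z‖) * (1 - ‖z‖)) := by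
        rw [poissonKernel_zero_circle, ← hδ_def]
        field_simp
        ring
    _ ≤ 2 * (1 + (π / 2 * (1 + α)) ^ 2) * (1 - ‖z‖) := by
        rw [mul_comm 2, mul_assoc]
        gcongr
        linarith [hz.1]

lemma ofReal_poissonKernel_circle (hz : ‖z‖ < 1) (ζ : Circle) :
    (poissonKernel 0 z ζ : ℂ) =
      (1 - z * (ζ : ℂ)⁻¹)⁻¹ + (1 - conj z * ζ)⁻¹ * (conj z * ζ) := by
  have hne : (ζ : ℂ) - z ≠ 0 :=
    norm_pos_iff.1 ((sub_pos.2 hz).trans_le (one_sub_norm_le_norm_circle_sub z ζ))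
  have hne' : 1 - conj z * ζ ≠ 0 := by
    have : 1 - conj z * ζ = conj ((ζ : ℂ) - z) * ζ := by
      rw [map_sub, ← Circle.coe_inv_eq_conj, Circle.coe_inv, sub_mul,
        inv_mul_cancel₀ (Circle.coe_ne_zero ζ)]
    rw [this]
    exact mul_ne_zero ((map_ne_zero _).2 hne) (Circle.coe_ne_zero ζ)
  rw [poissonKernel_zero_circle]
  push_cast
  rw [← Complex.mul_conj', ← Complex.mul_conj', map_sub, ← Circle.coe_inv_eq_conj,
    Circle.coe_inv]
  have hζ := Circle.coe_ne_zero ζ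
  field_simp
  ring

lemma summable_norm_pow_toNat_mul_conj_pow_toNat (hz : ‖z‖ < 1) :
    Summable fun n : ℤ => ‖z ^ n.toNat * conj z ^ (-n).toNat‖ := by
  have hgeom := summable_geometric_of_lt_one (norm_nonneg z) hz
  refine .of_nat_of_neg ?_ ?_ <;> simpa using hgeom

lemma hasSum_poissonKernel_circle (hz : ‖z‖ < 1) (t : AddCircle (2 * π)) :
    HasSum (fun n : ℤ => z ^ n.toNat * conj z ^ (-n).toNat * fourier (-n) t)
      (poissonKernel 0 z (toCircle t) : ℂ) := by
  have hw : ‖z * (toCircle t : ℂ)⁻¹‖ < 1 := by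
    rwa [norm_mul, norm_inv, Circle.norm_coe, inv_one, mul_one]
  have hv : ‖conj z * toCircle t‖ < 1 := by
    rwa [norm_mul, RCLike.norm_conj, Circle.norm_coe, mul_one]
  rw [ofReal_poissonKernel_circle hz]
  refine .of_nat_of_neg_add_one
    ((hasSum_geometric_of_norm_lt_one hw).congr_fun fun n => ?_)
    (((hasSum_geometric_of_norm_lt_one hv).mul_right _).congr_fun fun n => ?_)
  · rw [fourier_eq_zpow]
    simp [mul_pow]
  · have hn : ((n : ℤ) + 1).toNat = n + 1 := by omega
    have hn' : (-((n : ℤ) + 1)).toNat = 0 := by omega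
    rw [neg_neg, hn, hn', pow_zero, one_mul, fourier_eq_zpow, ← pow_succ, mul_pow]
    norm_cast

variable {E : Type*} [NormedAddCommGroup E] [NormedSpace ℂ E]

/-- The Poisson integral of a function `φ` on the unit circle, parametrized by the angle. -/
noncomputable def poissonIntegral (φ : AddCircle (2 * π) → E) (z : ℂ) : E :=
  ∫ t, poissonKernel 0 z (toCircle t) • φ t ∂haarAddCircle

variable [CompleteSpace E] {φ : AddCircle (2 * π) → E}

lemma hasSum_poissonIntegral (hz : ‖z‖ < 1) (hφ : Integrable φ haarAddCircle)
    (hneg : ∀ n < 0, fourierCoeff φ n = 0) :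
    HasSum (fun n : ℕ => z ^ n • fourierCoeff φ n) (poissonIntegral φ z) := by
  have hsum := hasSum_fourierCoeff_smul (summable_norm_pow_toNat_mul_conj_pow_toNat hz)
    (k := id) (hasSum_poissonKernel_circle hz) hφ
  simp only [Complex.coe_smul, id] at hsum
  rw [← (Nat.cast_injective (R := ℤ)).hasSum_iff] at hsum
  · simpa [Function.comp_def, poissonIntegral] using hsum
  · intro n hn
    rw [hneg n (by by_contra! hn0; exact hn (CanLift.prf n hn0)), smul_zero]

lemma integral_poissonKernel (hz : ‖z‖ < 1) :
    ∫ t : AddCircle (2 * π), poissonKernel 0 z (toCircle t) ∂haarAddCircle = 1 := by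
  have hcoeff (n : ℤ) (hn : n ≠ 0) : fourierCoeff (fun _ : AddCircle (2 * π) => (1 : ℂ)) n = 0 := by
    rw [fourierCoeff_one, Pi.single_eq_of_ne hn]
  have hsum := hasSum_poissonIntegral hz (integrable_const (1 : ℂ)) fun n hn => hcoeff n hn.ne
  have hsingle := hsum.unique (hasSum_single 0 fun n hn => by
    rw [hcoeff n (by exact_mod_cast hn), smul_zero])
  rw [poissonIntegral, integral_smul_const, pow_zero, one_smul, Nat.cast_zero, fourierCoeff_one,
    Pi.single_eq_same] at hsingle
  simpa using hsingle

lemma tendsto_poissonIntegral (hφ : Integrable φ haarAddCircle) {t : AddCircle (2 * π)}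
    (ht : Tendsto (ballDensity haarAddCircle (fun s => ‖φ s - φ t‖) t) (𝓝[>] 0) (𝓝 0)) (α : ℝ) :
    Tendsto (poissonIntegral φ) (𝓝[stolz α (toCircle t)] (toCircle t : ℂ)) (𝓝 (φ t)) := by
  have hscale : Tendsto (fun z : ℂ => 1 - ‖z‖) (𝓝[stolz α (toCircle t)] (toCircle t : ℂ))
      (𝓝[>] 0) :=
    tendsto_nhdsWithin_iff.2 ⟨(Continuous.tendsto' (by fun_prop) _ _ (by
      rw [Circle.norm_coe, sub_self])).mono_left
      nhdsWithin_le_nhds, eventually_mem_nhdsWithin.mono fun z hz => sub_pos.2 hz.1⟩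
  have hlim := tendsto_integral_zero_of_norm_mul_le (hφ.sub (integrable_const (φ t))).norm
    (fun s => norm_nonneg _) ht hscale (C := 2 * (1 + (π / 2 * (1 + α)) ^ 2)) (by positivity)
    (g := fun z s => poissonKernel 0 z (toCircle s) • (φ s - φ t)) ?_
  · rw [← tendsto_sub_nhds_zero_iff]
    refine hlim.congr' (eventually_mem_nhdsWithin.mono fun z hz => ?_)
    have hbdd : MemLp (fun s : AddCircle (2 * π) => poissonKernel 0 z (toCircle s)) ⊤
        haarAddCircle :=
      ((continuous_poissonKernel_circle hz.1).comp
        continuous_toCircle).memLp_top_of_hasCompactSupport (.of_compactSpace _) _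
    have hint {g : AddCircle (2 * π) → E} (hg : Integrable g haarAddCircle) :
        Integrable (fun s => poissonKernel 0 z (toCircle s) • g s) haarAddCircle :=
      Integrable.smul_of_top_right (𝕜 := ℝ) hg hbdd
    simp only [smul_sub]
    rw [integral_sub (hint hφ) (hint (integrable_const _)), integral_smul_const,
      integral_poissonKernel hz.1, one_smul, poissonIntegral]
  · filter_upwards [self_mem_nhdsWithin] with z hz s
    rw [norm_smul, Real.norm_of_nonneg (poissonKernel_circle_nonneg hz.1 _), mul_right_comm]
    exact mul_le_mul_of_nonneg_right (poissonKernel_mul_le hz s) (norm_nonneg _)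

lemma ae_hasNTLimit_poissonIntegral {φ : AddCircle (2 * π) → ℂ} (hφ : Integrable φ haarAddCircle) :
    ∀ᵐ t ∂haarAddCircle, HasNTLimit (poissonIntegral φ) (toCircle t) (φ t) :=
  (ae_tendsto_ballDensity_norm_sub hφ).mono fun _ ht α _ => tendsto_poissonIntegral hφ ht α

end PoissonIntegral

section PowerSeries

lemma exists_hasSum_pow_smul {E : Type*} [NormedAddCommGroup E] [NormedSpace ℂ E]
    [CompleteSpace E] {f : ℂ → E} (hf : DifferentiableOn ℂ f (ball 0 1)) :
    ∃ c : ℕ → E, ∀ z : ℂ, ‖z‖ < 1 → HasSum (fun n => z ^ n • c n) (f z) := by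
  refine ⟨fun n => (n.factorial : ℂ)⁻¹ • iteratedDeriv n f 0, fun z hz => ?_⟩
  have htaylor := Complex.hasSum_taylorSeries_on_ball hf (mem_ball_zero_iff.2 hz)
  simpa only [sub_zero, smul_comm (_ ^ _) _ (_ : E)] using htaylor

variable {f : ℂ → ℂ} {c : ℕ → ℂ}

lemma differentiableOn_of_hasSum_pow_smul
    (hf : ∀ z : ℂ, ‖z‖ < 1 → HasSum (fun n => z ^ n • c n) (f z)) :
    DifferentiableOn ℂ f (ball 0 1) := by
  intro z hz
  obtain ⟨ρ, hzρ, hρ⟩ := exists_between (mem_ball_zero_iff.1 hz)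
  have hnorm : ‖(ρ : ℂ)‖ = ρ := Complex.norm_of_nonneg ((norm_nonneg z).trans hzρ.le)
  have hdiff : DifferentiableOn ℂ (fun w : ℂ => ∑' n, w ^ n • c n) (ball 0 ρ) :=
    Complex.differentiableOn_tsum_of_summable_norm (hf ρ (hnorm.trans_lt hρ)).summable.norm
      (fun n => by fun_prop) isOpen_ball fun n w hw => by
        rw [norm_smul, norm_smul, norm_pow, norm_pow, hnorm]
        gcongr
        exact (mem_ball_zero_iff.1 hw).le
  have heq : Set.EqOn f (fun w : ℂ => ∑' n, w ^ n • c n) (ball 0 ρ) := fun w hw =>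
    (hf w ((mem_ball_zero_iff.1 hw).trans hρ)).tsum_eq.symm
  exact ((hdiff.congr heq).differentiableAt
    (isOpen_ball.mem_nhds (mem_ball_zero_iff.2 hzρ))).differentiableWithinAt

lemma norm_ofReal_mul_toCircle {r : ℝ} (hr : 0 ≤ r) (t : AddCircle (2 * π)) :
    ‖(r : ℂ) * toCircle t‖ = r := by
  rw [norm_mul, Circle.norm_coe, mul_one, Complex.norm_of_nonneg hr]

lemma hasSum_norm_sq_mul_pow (hf : ∀ z : ℂ, ‖z‖ < 1 → HasSum (fun n => z ^ n • c n) (f z))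
    {r : ℝ} (hr0 : 0 ≤ r) (hr1 : r < 1) :
    HasSum (fun n => ‖c n‖ ^ 2 * r ^ (2 * n)) (∫ ζ, ‖f (r * ζ)‖ ^ 2 ∂circleMeasure) := by
  have hmem (t : AddCircle (2 * π)) : ‖(r : ℂ) * toCircle t‖ < 1 := by
    rwa [norm_ofReal_mul_toCircle hr0]
  have hcont : Continuous fun t : AddCircle (2 * π) => f (r * toCircle t) :=
    (differentiableOn_of_hasSum_pow_smul hf).continuousOn.comp_continuous
      (continuous_const.mul (continuous_subtype_val.comp continuous_toCircle))
      fun t => mem_ball_zero_iff.2 (hmem t)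
  have hsum : Summable fun n => ‖(r : ℂ) ^ n * c n‖ :=
    (hf r (by rwa [Complex.norm_of_nonneg hr0])).summable.norm
  have hfourier (t : AddCircle (2 * π)) :
      HasSum (fun n : ℕ => (r : ℂ) ^ n * c n * fourier (n : ℤ) t) (f (r * toCircle t)) := by
    refine (hf _ (hmem t)).congr_fun fun n => ?_
    rw [fourier_eq_zpow, zpow_natCast, smul_eq_mul, mul_pow, mul_right_comm]
  have hparseval := hasSum_norm_sq_of_hasSum_fourier hsum Nat.cast_injective hfourier
    (hcont.memLp_of_hasCompactSupport (.of_compactSpace _))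
  rw [integral_circleMeasure]
  refine hparseval.congr_fun fun n => ?_
  rw [norm_mul, norm_pow, Complex.norm_of_nonneg hr0, mul_pow, ← pow_mul, mul_comm, mul_comm 2]

lemma summable_norm_sq_of_eventually_le
    (hf : ∀ z : ℂ, ‖z‖ < 1 → HasSum (fun n => z ^ n • c n) (f z)) {C : ℝ}
    (hC : ∀ᶠ r : ℝ in 𝓝[<] 1, ∫ ζ, ‖f (r * ζ)‖ ^ 2 ∂circleMeasure ≤ C) :
    Summable fun n => ‖c n‖ ^ 2 := by
  refine summable_of_sum_range_le (c := C) (fun n => by positivity) fun N => ?_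
  have hlim : Tendsto (fun r : ℝ => ∑ n ∈ Finset.range N, ‖c n‖ ^ 2 * r ^ (2 * n)) (𝓝[<] 1)
      (𝓝 (∑ n ∈ Finset.range N, ‖c n‖ ^ 2)) :=
    (Continuous.tendsto' (by fun_prop) _ _ (by simp)).mono_left nhdsWithin_le_nhds
  refine le_of_tendsto hlim ?_
  filter_upwards [hC, Ioo_mem_nhdsLT zero_lt_one] with r hr ⟨hr0, hr1⟩
  exact (sum_le_hasSum _ (fun n _ => by positivity) (hasSum_norm_sq_mul_pow hf hr0.le hr1)).trans hr

lemma memH2_iff_summable_norm_sq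
    (hf : ∀ z : ℂ, ‖z‖ < 1 → HasSum (fun n => z ^ n • c n) (f z)) :
    MemH2 f ↔ Summable fun n => ‖c n‖ ^ 2 := by
  constructor
  · rintro ⟨-, L, hL⟩
    exact summable_norm_sq_of_eventually_le hf (hL.eventually_le_const (lt_add_one L))
  · refine fun hc => ⟨differentiableOn_of_hasSum_pow_smul hf, ∑' n, ‖c n‖ ^ 2, ?_⟩
    have hlim : Tendsto (fun r : ℝ => ∑' n, ‖c n‖ ^ 2 * r ^ (2 * n)) (𝓝[<] 1)
        (𝓝 (∑' n, ‖c n‖ ^ 2)) := by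
      refine tendsto_tsum_of_dominated_convergence hc (fun n => ?_) ?_
      · exact (Continuous.tendsto' (by fun_prop) _ _ (by simp)).mono_left nhdsWithin_le_nhds
      · filter_upwards [Ioo_mem_nhdsLT zero_lt_one] with r ⟨hr0, hr1⟩ n
        rw [Real.norm_of_nonneg (by positivity)]
        exact mul_le_of_le_one_right (by positivity) (pow_le_one₀ hr0.le hr1.le)
    refine hlim.congr' ?_
    filter_upwards [Ioo_mem_nhdsLT zero_lt_one] with r ⟨hr0, hr1⟩
    exact (hasSum_norm_sq_mul_pow hf hr0.le hr1).tsum_eq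

lemma memH2_of_norm_le (hf : DifferentiableOn ℂ f (ball 0 1)) {C : ℝ}
    (hC : ∀ z ∈ ball (0 : ℂ) 1, ‖f z‖ ≤ C) : MemH2 f := by
  obtain ⟨c, hc⟩ := exists_hasSum_pow_smul hf
  refine (memH2_iff_summable_norm_sq hc).2 (summable_norm_sq_of_eventually_le hc (C := C ^ 2) ?_)
  filter_upwards [Ioo_mem_nhdsLT zero_lt_one] with r ⟨hr0, hr1⟩
  rw [integral_circleMeasure]
  have hbound (t : AddCircle (2 * π)) : ‖‖f (r * toCircle t)‖ ^ 2‖ ≤ C ^ 2 := by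
    rw [norm_pow, norm_norm]
    gcongr
    exact hC _ (mem_ball_zero_iff.2 (by rwa [norm_ofReal_mul_toCircle hr0.le]))
  refine (Real.le_norm_self _).trans ?_
  simpa using norm_integral_le_of_norm_le_const (μ := haarAddCircle) (ae_of_all _ hbound)

lemma memH2_pow (n : ℕ) : MemH2 fun z => z ^ n := by
  refine memH2_of_norm_le (C := 1) (by fun_prop) fun z hz => ?_
  rw [norm_pow]
  exact pow_le_one₀ (norm_nonneg z) (mem_ball_zero_iff.1 hz).le

end PowerSeries

section NontangentialLimits

variable {f g : ℂ → ℂ} {ζ L M : ℂ}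

lemma tendsto_ofReal_mul_stolz (hζ : ‖ζ‖ = 1) {α : ℝ} (hα : 1 < α) :
    Tendsto (fun r : ℝ => (r : ℂ) * ζ) (𝓝[<] 1) (𝓝[stolz α ζ] ζ) := by
  refine tendsto_nhdsWithin_iff.2
    ⟨(Continuous.tendsto' (by fun_prop) _ _ (by simp)).mono_left nhdsWithin_le_nhds, ?_⟩
  filter_upwards [Ioo_mem_nhdsLT zero_lt_one] with r ⟨hr0, hr1⟩
  have hnorm : ‖(r : ℂ) * ζ‖ = r := by rw [norm_mul, hζ, mul_one, Complex.norm_of_nonneg hr0.le]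
  have hdist : ‖(r : ℂ) * ζ - ζ‖ = 1 - r := by
    rw [← sub_one_mul, norm_mul, hζ, mul_one, norm_sub_rev, ← Complex.ofReal_one,
      ← Complex.ofReal_sub, Complex.norm_of_nonneg (sub_nonneg.2 hr1.le)]
  refine ⟨hnorm.trans_lt hr1, ?_⟩
  rw [hdist, hnorm]
  exact lt_mul_left (sub_pos.2 hr1) hα

lemma HasNTLimit.tendsto_radial (h : HasNTLimit f ζ L) (hζ : ‖ζ‖ = 1) :
    Tendsto (fun r : ℝ => f (r * ζ)) (𝓝[<] 1) (𝓝 L) :=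
  (h 2 one_lt_two).comp (tendsto_ofReal_mul_stolz hζ one_lt_two)

lemma HasNTLimit.boundaryValue_eq (h : HasNTLimit f ζ L) (hζ : ‖ζ‖ = 1) : boundaryValue f ζ = L :=
  (h.tendsto_radial hζ).limUnder_eq

lemma HasNTLimit.unique (hL : HasNTLimit f ζ L) (hM : HasNTLimit f ζ M) (hζ : ‖ζ‖ = 1) : L = M :=
  tendsto_nhds_unique (hL.tendsto_radial hζ) (hM.tendsto_radial hζ)

lemma HasNTLimit.congr (h : HasNTLimit f ζ L) (hfg : Set.EqOn f g (ball 0 1)) :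
    HasNTLimit g ζ L := fun α hα =>
  (h α hα).congr' (eventually_mem_nhdsWithin.mono fun _ hz => hfg (mem_ball_zero_iff.2 hz.1))

lemma HasNTLimit.mul (hf : HasNTLimit f ζ L) (hg : HasNTLimit g ζ M) :
    HasNTLimit (fun z => f z * g z) ζ (L * M) :=
  fun α hα => (hf α hα).mul (hg α hα)

lemma HasNTLimit.div (hf : HasNTLimit f ζ L) (hg : HasNTLimit g ζ M) (hM : M ≠ 0) :
    HasNTLimit (fun z => f z / g z) ζ (L / M) :=
  fun α hα => (hf α hα).div (hg α hα) hM

lemma hasNTLimit_of_continuousAt (hf : ContinuousAt f ζ) : HasNTLimit f ζ (f ζ) :=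
  fun _ _ => hf.tendsto.mono_left nhdsWithin_le_nhds

end NontangentialLimits

section BoundaryFunction

variable {f : ℂ → ℂ}

/-- The radial boundary function of `f`, parametrized by the angle. It is only meaningful at the
angles where the radial limit exists. -/
noncomputable def boundaryFun (f : ℂ → ℂ) (t : AddCircle (2 * π)) : ℂ :=
  boundaryValue f (toCircle t)

lemma boundaryFun_ae_eq {φ : AddCircle (2 * π) → ℂ}
    (h : ∀ᵐ t ∂haarAddCircle, HasNTLimit f (toCircle t) (φ t)) :
    boundaryFun f =ᵐ[haarAddCircle] φ :=
  h.mono fun _ ht => ht.boundaryValue_eq (Circle.norm_coe _)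

lemma poissonIntegral_zero (φ : AddCircle (2 * π) → ℂ) :
    poissonIntegral φ 0 = fourierCoeff φ 0 := by
  simp only [poissonIntegral, poissonKernel_zero_circle, sub_zero, norm_zero, Circle.norm_coe,
    fourierCoeff, neg_zero, fourier_zero, zero_pow two_ne_zero, one_pow, div_one, one_smul]

lemma memH2_poissonIntegral {φ : AddCircle (2 * π) → ℂ} (hφ : MemLp φ 2 haarAddCircle)
    (hneg : ∀ n < 0, fourierCoeff φ n = 0) : MemH2 (poissonIntegral φ) :=
  (memH2_iff_summable_norm_sq fun _ hz =>
    hasSum_poissonIntegral hz (hφ.integrable one_le_two) hneg).2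
    ((hasSum_sq_fourierCoeff_of_memLp hφ).summable.comp_injective Nat.cast_injective)

lemma MemH2.exists_eqOn_poissonIntegral (hf : MemH2 f) :
    ∃ φ : AddCircle (2 * π) → ℂ, MemLp φ 2 haarAddCircle ∧ (∀ n < 0, fourierCoeff φ n = 0) ∧
      Set.EqOn (poissonIntegral φ) f (ball 0 1) := by
  obtain ⟨c, hc⟩ := exists_hasSum_pow_smul hf.1
  have hsq : Summable fun n : ℤ => ‖Function.extend ((↑) : ℕ → ℤ) c 0 n‖ ^ 2 := by
    rw [← Nat.cast_injective.summable_iff]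
    · simpa only [Function.comp_def, Nat.cast_injective.extend_apply] using
        (memH2_iff_summable_norm_sq hc).1 hf
    · intro n hn
      rw [Function.extend_apply' _ _ _ hn, Pi.zero_apply, norm_zero, zero_pow two_ne_zero]
  obtain ⟨φ, hφ, hcoeff⟩ := exists_memLp_fourierCoeff_eq (T := 2 * π) hsq
  have hneg : ∀ n < 0, fourierCoeff φ n = 0 := fun n hn => by
    rw [hcoeff, Function.extend_apply' _ _ _ (by rintro ⟨k, rfl⟩; omega), Pi.zero_apply]
  refine ⟨φ, hφ, hneg, fun z hz => ?_⟩
  rw [mem_ball_zero_iff] at hz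
  have hsum := hasSum_poissonIntegral hz (hφ.integrable one_le_two) hneg
  simp only [hcoeff, Nat.cast_injective.extend_apply] at hsum
  exact hsum.unique (hc z hz)

lemma ae_hasNTLimit_of_eqOn_poissonIntegral {φ : AddCircle (2 * π) → ℂ}
    (hφ : MemLp φ 2 haarAddCircle) (heq : Set.EqOn (poissonIntegral φ) f (ball 0 1)) :
    ∀ᵐ t ∂haarAddCircle, HasNTLimit f (toCircle t) (φ t) :=
  (ae_hasNTLimit_poissonIntegral (hφ.integrable one_le_two)).mono fun _ ht => ht.congr heq

lemma MemH2.ae_hasNTLimit_boundaryFun (hf : MemH2 f) :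
    ∀ᵐ t ∂haarAddCircle, HasNTLimit f (toCircle t) (boundaryFun f t) := by
  obtain ⟨φ, hφ, -, heq⟩ := hf.exists_eqOn_poissonIntegral
  have hlim := ae_hasNTLimit_of_eqOn_poissonIntegral hφ heq
  filter_upwards [hlim, boundaryFun_ae_eq hlim] with t ht hft
  rwa [hft]

lemma MemH2.memLp_boundaryFun (hf : MemH2 f) : MemLp (boundaryFun f) 2 haarAddCircle := by
  obtain ⟨φ, hφ, -, heq⟩ := hf.exists_eqOn_poissonIntegral
  exact (memLp_congr_ae (boundaryFun_ae_eq (ae_hasNTLimit_of_eqOn_poissonIntegral hφ heq))).2 hφ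

lemma MemH2.fourierCoeff_boundaryFun_of_neg (hf : MemH2 f) {n : ℤ} (hn : n < 0) :
    fourierCoeff (boundaryFun f) n = 0 := by
  obtain ⟨φ, hφ, hneg, heq⟩ := hf.exists_eqOn_poissonIntegral
  rw [fourierCoeff_congr_ae (boundaryFun_ae_eq (ae_hasNTLimit_of_eqOn_poissonIntegral hφ heq)),
    hneg n hn]

lemma MemH2.fourierCoeff_boundaryFun_zero (hf : MemH2 f) :
    fourierCoeff (boundaryFun f) 0 = f 0 := by
  obtain ⟨φ, hφ, -, heq⟩ := hf.exists_eqOn_poissonIntegral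
  rw [fourierCoeff_congr_ae (boundaryFun_ae_eq (ae_hasNTLimit_of_eqOn_poissonIntegral hφ heq)),
    ← poissonIntegral_zero, heq (mem_ball_self one_pos)]

lemma exists_memH2_hasNTLimit_iff {ψ : AddCircle (2 * π) → ℂ} (hψ : MemLp ψ 2 haarAddCircle) :
    (∃ G : ℂ → ℂ, MemH2 G ∧ G 0 = 0 ∧ ∀ᵐ t ∂haarAddCircle, HasNTLimit G (toCircle t) (ψ t)) ↔
      ∀ n ≤ 0, fourierCoeff ψ n = 0 := by
  constructor
  · rintro ⟨G, hG, hG0, hlim⟩ n hn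
    rw [← fourierCoeff_congr_ae (boundaryFun_ae_eq hlim)]
    rcases hn.lt_or_eq with hneg | rfl
    · exact hG.fourierCoeff_boundaryFun_of_neg hneg
    · rw [hG.fourierCoeff_boundaryFun_zero, hG0]
  · intro hcoeff
    exact ⟨poissonIntegral ψ, memH2_poissonIntegral hψ fun n hn => hcoeff n hn.le,
      (poissonIntegral_zero ψ).trans (hcoeff 0 le_rfl),
      ae_hasNTLimit_poissonIntegral (hψ.integrable one_le_two)⟩

end BoundaryFunction

section InnerFunctions

variable {u f : ℂ → ℂ}

lemma IsInner.memH2 (hu : IsInner u) : MemH2 u :=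
  hu.2.1.elim fun _ hC => memH2_of_norm_le hu.1 hC

lemma IsInner.ae_norm_boundaryFun (hu : IsInner u) :
    ∀ᵐ t ∂haarAddCircle, ‖boundaryFun u t‖ = 1 := by
  filter_upwards [ae_circleMeasure_iff.1 hu.2.2] with t ⟨L, hL, hlim⟩
  rwa [boundaryFun, boundaryValue, hlim.limUnder_eq]

lemma IsInner.memLp_top_boundaryFun (hu : IsInner u) : MemLp (boundaryFun u) ⊤ haarAddCircle :=
  memLp_top_of_bound hu.memH2.memLp_boundaryFun.1 1 (hu.ae_norm_boundaryFun.mono fun _ ht => ht.le)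

lemma memLp_boundaryFun_mul_conj (hf : MemH2 f) (hu : MemLp (boundaryFun u) ⊤ haarAddCircle) :
    MemLp (fun t => boundaryFun f t * conj (boundaryFun u t)) 2 haarAddCircle :=
  hu.star.mul hf.memLp_boundaryFun

lemma innerH2_mul_right {h : ℂ → ℂ} (f : ℂ → ℂ) (hu : MemH2 u) (hh : MemH2 h) :
    innerH2 f (fun z => u z * h z) =
      ∫ t, boundaryFun f t * conj (boundaryFun u t) * conj (boundaryFun h t) ∂haarAddCircle := by
  rw [innerH2, integral_circleMeasure]
  refine integral_congr_ae ?_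
  filter_upwards [hu.ae_hasNTLimit_boundaryFun, hh.ae_hasNTLimit_boundaryFun] with t hut hht
  rw [(hut.mul hht).boundaryValue_eq (Circle.norm_coe _), map_mul, mul_assoc]
  rfl

lemma boundaryFun_pow (n : ℕ) : boundaryFun (fun z => z ^ n) = fourier (T := 2 * π) n := by
  funext t
  rw [fourier_eq_zpow, zpow_natCast]
  exact (hasNTLimit_of_continuousAt (continuous_pow n).continuousAt).boundaryValue_eq
    (Circle.norm_coe _)

lemma innerH2_mul_pow (f : ℂ → ℂ) (hu : MemH2 u) (n : ℕ) :
    innerH2 f (fun z => u z * z ^ n) =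
      fourierCoeff (fun t => boundaryFun f t * conj (boundaryFun u t)) n := by
  rw [innerH2_mul_right f hu (memH2_pow n), boundaryFun_pow]
  exact integral_congr_ae (ae_of_all _ fun t => by simp only [fourier_neg, smul_eq_mul, mul_comm])

lemma mem_modelSpace_iff (hu : MemH2 u) (hu' : MemLp (boundaryFun u) ⊤ haarAddCircle)
    (hf : MemH2 f) : f ∈ modelSpace u ↔
      ∀ n : ℕ, fourierCoeff (fun t => boundaryFun f t * conj (boundaryFun u t)) n = 0 := by
  refine ⟨fun h n => ?_, fun hcoeff => ⟨hf, fun h hh => ?_⟩⟩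
  · rw [← innerH2_mul_pow f hu, h.2 _ (memH2_pow n)]
  · rw [innerH2_mul_right f hu hh]
    refine integral_mul_conj_eq_zero_of_fourierCoeff (memLp_boundaryFun_mul_conj hf hu')
      hh.memLp_boundaryFun fun n => ?_
    rcases lt_or_ge n 0 with hn | hn
    · exact .inr (hh.fourierCoeff_boundaryFun_of_neg hn)
    · lift n to ℕ using hn
      exact .inl (hcoeff n)

end InnerFunctions

section Reflection

variable {α : ℝ} {z ζ L : ℂ}

lemma inv_mem_stolzExt_inv_iff (hζ : ‖ζ‖ = 1) (hz : z ≠ 0) :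
    z⁻¹ ∈ stolzExt α ζ⁻¹ ↔ z ∈ stolz α ζ := by
  have hz0 : 0 < ‖z‖ := norm_pos_iff.2 hz
  have hζ0 : ζ ≠ 0 := norm_pos_iff.1 (hζ ▸ one_pos)
  have hdist : ‖z⁻¹ - ζ⁻¹‖ = ‖z - ζ‖ / ‖z‖ := by
    rw [inv_sub_inv hz hζ0, norm_div, norm_mul, hζ, mul_one, norm_sub_rev]
  have hgap : α * (‖z⁻¹‖ - 1) = α * (1 - ‖z‖) / ‖z‖ := by
    rw [norm_inv]
    field_simp
  rw [stolz, stolzExt, Set.mem_ofPred_eq, Set.mem_ofPred_eq, hdist, hgap,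
    div_lt_div_iff_of_pos_right hz0, norm_inv, one_lt_inv₀ hz0]

lemma map_inv_nhdsWithin_stolz (hζ : ‖ζ‖ = 1) :
    map (·⁻¹) (𝓝[stolz α ζ] ζ) = 𝓝[stolzExt α ζ⁻¹] ζ⁻¹ := by
  have hζ0 : ζ ≠ 0 := norm_pos_iff.1 (hζ ▸ one_pos)
  refine map_eq_of_inverse (·⁻¹) (funext inv_inv) ?_ ?_
  · refine tendsto_nhdsWithin_iff.2 ⟨(tendsto_inv₀ hζ0).mono_left nhdsWithin_le_nhds, ?_⟩
    filter_upwards [self_mem_nhdsWithin, nhdsWithin_le_nhds (eventually_ne_nhds hζ0)]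
      with z hz hz0 using (inv_mem_stolzExt_inv_iff hζ hz0).2 hz
  · have hlim := tendsto_inv₀ (inv_ne_zero hζ0)
    rw [inv_inv] at hlim
    refine tendsto_nhdsWithin_iff.2 ⟨hlim.mono_left nhdsWithin_le_nhds, ?_⟩
    filter_upwards [self_mem_nhdsWithin] with z hz
    have hz0 : z ≠ 0 := norm_pos_iff.1 (one_pos.trans hz.1)
    exact (inv_mem_stolzExt_inv_iff hζ (inv_ne_zero hz0)).1 (by rwa [inv_inv])

lemma invSphere_zero : invSphere 0 = OnePoint.infty :=
  if_pos rfl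

lemma invSphere_of_ne_zero {w : ℂ} (hw : w ≠ 0) : invSphere w = (w⁻¹ : ℂ) :=
  if_neg hw

lemma hasNTLimitExt_inv_iff {F : OnePoint ℂ → ℂ} (hζ : ‖ζ‖ = 1) :
    HasNTLimitExt F ζ⁻¹ L ↔ HasNTLimit (fun w => F (invSphere w)) ζ L := by
  have hζ0 : ζ ≠ 0 := norm_pos_iff.1 (hζ ▸ one_pos)
  refine forall₂_congr fun α _ => ?_
  rw [← map_inv_nhdsWithin_stolz hζ, tendsto_map'_iff]
  refine tendsto_congr' ?_
  filter_upwards [nhdsWithin_le_nhds (eventually_ne_nhds hζ0)] with w hw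
  rw [Function.comp_apply, invSphere_of_ne_zero hw]

lemma MemH2.congr {f g : ℂ → ℂ} (hf : MemH2 f) (hfg : Set.EqOn f g (ball 0 1)) : MemH2 g := by
  obtain ⟨c, hc⟩ := exists_hasSum_pow_smul hf.1
  have hc' (z : ℂ) (hz : ‖z‖ < 1) : HasSum (fun n => z ^ n • c n) (g z) :=
    hfg (mem_ball_zero_iff.2 hz) ▸ hc z hz
  exact (memH2_iff_summable_norm_sq hc').2 ((memH2_iff_summable_norm_sq hc).1 hf)

lemma memH2Ext_iff {F : OnePoint ℂ → ℂ} : MemH2Ext F ↔ MemH2 fun w => F (invSphere w) := by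
  constructor
  · rintro ⟨g, hg, hF, hF0⟩
    refine hg.congr fun w hw => ?_
    rcases eq_or_ne w 0 with rfl | hw0
    · rw [invSphere_zero, hF0]
    · have hw1 : 1 < ‖w⁻¹‖ := by
        rw [norm_inv]
        exact (one_lt_inv₀ (norm_pos_iff.2 hw0)).2 (mem_ball_zero_iff.1 hw)
      rw [invSphere_of_ne_zero hw0, hF _ hw1, one_div, inv_inv]
  · refine fun h => ⟨_, h, fun z hz => ?_, by rw [invSphere_zero]⟩
    have hz0 : z ≠ 0 := norm_pos_iff.1 (one_pos.trans hz)
    rw [invSphere_of_ne_zero (one_div_ne_zero hz0), one_div, inv_inv]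

lemma exists_comp_invSphere_eq (G : ℂ → ℂ) :
    ∃ F : OnePoint ℂ → ℂ, (fun w => F (invSphere w)) = G := by
  refine ⟨fun x => x.elim (G 0) fun z => G z⁻¹, funext fun w => ?_⟩
  rcases eq_or_ne w 0 with rfl | hw
  · simp only [invSphere_zero, OnePoint.elim_infty]
  · simp only [invSphere_of_ne_zero hw, OnePoint.elim_some, inv_inv]

lemma ae_comp_neg_iff {p : AddCircle (2 * π) → Prop} :
    (∀ᵐ t ∂haarAddCircle, p (-t)) ↔ ∀ᵐ t ∂haarAddCircle, p t := by
  rw [← measurableEmbedding_neg.ae_map_iff, Measure.map_neg_eq_self]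

variable {g : ℂ → ℂ} {q : AddCircle (2 * π) → ℂ}

lemma isPseudocontinuation_iff (hg : MeromorphicOn g (ball 0 1))
    (hq : ∀ᵐ t ∂haarAddCircle, HasNTLimit g (toCircle t) (q t)) {F : OnePoint ℂ → ℂ}
    (hF : MemH2Ext F) : IsPseudocontinuation g F ↔
      ∀ᵐ t ∂haarAddCircle, HasNTLimit (fun w => F (invSphere w)) (toCircle t) (q (-t)) := by
  have hmero : MeromorphicOnExt F :=
    ((memH2Ext_iff.1 hF).1.analyticOnNhd isOpen_ball).meromorphicOn
  simp only [IsPseudocontinuation, hg, hmero, true_and, ae_circleMeasure_iff]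
  rw [← ae_comp_neg_iff]
  refine eventually_congr ?_
  filter_upwards [ae_comp_neg_iff.2 hq] with t ht
  have hreflect (L : ℂ) : HasNTLimitExt F (toCircle (-t)) L ↔
      HasNTLimit (fun w => F (invSphere w)) (toCircle t) L := by
    rw [toCircle_neg, Circle.coe_inv, hasNTLimitExt_inv_iff (Circle.norm_coe _)]
  simp only [hreflect]
  constructor
  · rintro ⟨L, hgL, hFL⟩
    rwa [ht.unique hgL (Circle.norm_coe _)]
  · exact fun h => ⟨_, ht, h⟩

lemma exists_pseudocontinuation_iff (hg : MeromorphicOn g (ball 0 1))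
    (hq : MemLp q 2 haarAddCircle)
    (hlim : ∀ᵐ t ∂haarAddCircle, HasNTLimit g (toCircle t) (q t)) :
    (∃ F : OnePoint ℂ → ℂ, MemH2Ext F ∧ IsPseudocontinuation g F ∧ F OnePoint.infty = 0) ↔
      ∀ n : ℕ, fourierCoeff q n = 0 := by
  have hreflect : MemLp (fun t => q (-t)) 2 haarAddCircle :=
    hq.comp_measurePreserving (Measure.measurePreserving_neg haarAddCircle)
  calc
    _ ↔ ∃ G : ℂ → ℂ, MemH2 G ∧ G 0 = 0 ∧
        ∀ᵐ t ∂haarAddCircle, HasNTLimit G (toCircle t) (q (-t)) := by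
      constructor
      · rintro ⟨F, hF, hpc, hF0⟩
        exact ⟨_, memH2Ext_iff.1 hF, by rwa [invSphere_zero],
          (isPseudocontinuation_iff hg hlim hF).1 hpc⟩
      · rintro ⟨G, hG, hG0, hGlim⟩
        obtain ⟨F, rfl⟩ := exists_comp_invSphere_eq G
        have hF : MemH2Ext F := memH2Ext_iff.2 hG
        simp only [invSphere_zero] at hG0
        exact ⟨F, hF, (isPseudocontinuation_iff hg hlim hF).2 hGlim, hG0⟩
    _ ↔ ∀ n ≤ 0, fourierCoeff q (-n) = 0 := by
      simp only [exists_memH2_hasNTLimit_iff hreflect, fourierCoeff_comp_neg]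
    _ ↔ ∀ n : ℕ, fourierCoeff q n = 0 := by
      refine ⟨fun h n => by simpa only [neg_neg] using h (-n) (by omega), fun h n hn => ?_⟩
      obtain ⟨k, rfl⟩ := Int.exists_eq_neg_ofNat hn
      simpa only [neg_neg] using h k

end Reflection

end ModelSpace

theorem mainTheorem2 (u : ℂ → ℂ) (hu : ModelSpace.IsInner u) (f : ℂ → ℂ)
    (hf : ModelSpace.MemH2 f) :
    f ∈ ModelSpace.modelSpace u ↔
      ∃ F : OnePoint ℂ → ℂ, ModelSpace.MemH2Ext F ∧
        ModelSpace.IsPseudocontinuation (fun z => f z / u z) F ∧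
        F OnePoint.infty = 0 := by
  have hu' := hu.memLp_top_boundaryFun
  have hmero : MeromorphicOn (fun z => f z / u z) (ball 0 1) :=
    (hf.1.analyticOnNhd isOpen_ball).meromorphicOn.fun_div
      (hu.1.analyticOnNhd isOpen_ball).meromorphicOn
  rw [ModelSpace.mem_modelSpace_iff hu.memH2 hu' hf,
    ModelSpace.exists_pseudocontinuation_iff hmero (ModelSpace.memLp_boundaryFun_mul_conj hf hu')]
  filter_upwards [hf.ae_hasNTLimit_boundaryFun, hu.memH2.ae_hasNTLimit_boundaryFun,
    hu.ae_norm_boundaryFun] with t hft hut hnorm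
  rw [← Complex.inv_eq_conj hnorm, ← div_eq_mul_inv]
  exact hft.div hut (norm_pos_iff.1 (hnorm ▸ one_pos))
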